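/- Let $m_0,m\ge 0$ be integers and consider a discrete-time Markov chain of GI/M/1 type, with $m_0$ phases in level $0$, $m$ phases in each level $k\ge1$, and transition matrix $$P=\begin{pmatrix} B_1&B_0&&&\\ B_2&A_1&A_0&&\\ B_3&A_2&A_1&A_0&\\ \vdots&\vdots&\vdots&\vdots&\ddots\end{pmatrix}.$$ Assume that $P$ is stochastic, irreducible and positive recurrent. Let $x=(x_0,x_1,x_2,\dots)$ be its stationary probability vector, partitioned by levels, let $\pi_k=\sum_{j\ge k}x_j$ for $k\ge1$, and let $R$ be the (entrywise) minimal nonnegative solution of $R=\sum_{k\ge0}R^kA_k$. Put $$\widehat\Psi=\sum_{k\ge1}R^{k-1}A_k,\qquad \widehat\Psi_0=(A_0+A_1)+\sum_{k\ge2}R\,R^{k-2}A_k,\qquad R_1=B_0(I-\widehat\Psi)^{-1},$$ $$G_j=(I-\widehat\Psi)^{-1}\sum_{k\ge j+1}R^{k-j-1}A_k\quad(j\ge1).$$ Then all the series above (including those defining $\pi_k$) converge, the matrices $I-R$, $I-\widehat\Psi$, $I-\widehat\Psi_0$ are invertible, and the following hold. (a) For all $k\ge1$, $x_k=x_0R_1R^{k-1}$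 and $$\pi_k=x_0R_1(I-R)^{-1}R^{k-1}.$$ (b) Let $$\mathbb P=\begin{pmatrix} A_0+A_1&A_0&&&\\ A_2&A_1&A_0&&\\ A_3&A_2&A_1&A_0&\\ \vdots&\vdots&\vdots&\vdots&\ddots\end{pmatrix}.$$ Then $I-\mathbb P$ has the UL-type $RG$-factorization $$I-\mathbb P=(I-R_U)(I-\Phi_D)(I-G_L),$$ where $R_U$ is the block matrix with all blocks on the first superdiagonal equal to $R$ and all other blocks $0$, $\Phi_D=\mathrm{diag}(\widehat\Psi_0,\widehat\Psi,\widehat\Psi,\dots)$, and $G_L$ is the strictly lower triangular block matrix with blocks $(G_L)_{i,j}=G_{i-j}$ for $i>j\ge0$. Moreover, for all $k\ge1$, $$\pi_k=x_0B_0(I-\widehat\Psi_0)^{-1}R^{k-1}.$$ (c) Consequently $$x_0B_0(I-\widehat\Psi_0)^{-1}=x_0R_1(I-R)^{-1}.$$ -/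

import Mathlib

open Matrix

noncomputable section

namespace GIM1

/-! ### Discrete-time Markov chains on a countable state space -/

section Chain

variable {S : Type*}

/-- `P` is a (row-)stochastic matrix. -/
def IsStochastic (P : Matrix S S ℝ) : Prop :=
  (∀ s t, 0 ≤ P s t) ∧ ∀ s, HasSum (fun t => P s t) 1

open Classical in
/-- `firstPassage P n s t` is the probability that the chain, started in `s`, visits `t` for the
first time after time `0` at time `n + 1`. -/
def firstPassage (P : Matrix S S ℝ) : ℕ → S → S → ℝ
  | 0, s, t => P s t
  | n + 1, s, t => ∑' u, if u = t then 0 else P s u * firstPassage P n u t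

/-- Positive recurrence: from each state the chain returns with probability one, and the mean
return time is finite. -/
def IsPositiveRecurrent (P : Matrix S S ℝ) : Prop :=
  ∀ s, HasSum (fun n => firstPassage P n s s) 1 ∧
    Summable (fun n : ℕ => ((n : ℝ) + 1) * firstPassage P n s s)

/-- `x` is a stationary probability vector of `P`, that is, `x ≥ 0`, `x e = 1` and `x P = x`. -/
def IsStationary (P : Matrix S S ℝ) (x : S → ℝ) : Prop :=
  (∀ s, 0 ≤ x s) ∧ HasSum x 1 ∧ ∀ t, HasSum (fun s => x s * P s t) (x t)

end Chain

variable {m₀ m : ℕ}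

/-! ### The chain of GI/M/1 type -/

/-- The states: `Sum.inl i` is phase `i` of level `0`, and `Sum.inr (n, j)` is phase `j` of
level `n + 1`. -/
abbrev State (m₀ m : ℕ) : Type := Fin m₀ ⊕ (ℕ × Fin m)

/-- The transition matrix of GI/M/1 type with block rows
`(B₁, B₀, 0, …)`, `(B₂, A₁, A₀, 0, …)`, `(B₃, A₂, A₁, A₀, 0, …)`, ….
The matrices `B k` are used for `k ≥ 2` only. -/
def transition (B₁ : Matrix (Fin m₀) (Fin m₀) ℝ) (B₀ : Matrix (Fin m₀) (Fin m) ℝ)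
    (B : ℕ → Matrix (Fin m) (Fin m₀) ℝ) (A : ℕ → Matrix (Fin m) (Fin m) ℝ) :
    Matrix (State m₀ m) (State m₀ m) ℝ
  | Sum.inl i, Sum.inl j => B₁ i j
  | Sum.inl i, Sum.inr (l, j) => if l = 0 then B₀ i j else 0
  | Sum.inr (n, i), Sum.inl j => B (n + 2) i j
  | Sum.inr (n, i), Sum.inr (l, j) => if l ≤ n + 1 then A (n + 1 - l) i j else 0

/-- The subvector `x₀` of level `0`. -/
def levelZero (x : State m₀ m → ℝ) : Fin m₀ → ℝ := fun i => x (Sum.inl i)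

/-- The subvector `x_k` of level `k`, for `k ≥ 1`. -/
def level (x : State m₀ m → ℝ) (k : ℕ) : Fin m → ℝ := fun j => x (Sum.inr (k - 1, j))

/-- The tail vector `π_k = ∑_{j ≥ k} x_j`, for `k ≥ 1`. -/
def tailVec (x : State m₀ m → ℝ) (k : ℕ) : Fin m → ℝ := ∑' n : ℕ, level x (k + n)

/-- `R` is the (entrywise) minimal nonnegative solution of `R = ∑_{k ≥ 0} R ^ k A_k`. -/
def IsMinimalSolution (A : ℕ → Matrix (Fin m) (Fin m) ℝ) (R : Matrix (Fin m) (Fin m) ℝ) : Prop :=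
  (∀ i j, 0 ≤ R i j) ∧ HasSum (fun k : ℕ => R ^ k * A k) R ∧
    ∀ X : Matrix (Fin m) (Fin m) ℝ, (∀ i j, 0 ≤ X i j) → HasSum (fun k : ℕ => X ^ k * A k) X →
      ∀ i j, R i j ≤ X i j

/-- `psiSum A R n = ∑_{k ≥ n + 1} R ^ (k - n - 1) A_k`. -/
def psiSum (A : ℕ → Matrix (Fin m) (Fin m) ℝ) (R : Matrix (Fin m) (Fin m) ℝ) (n : ℕ) :
    Matrix (Fin m) (Fin m) ℝ :=
  ∑' k : ℕ, R ^ k * A (k + n + 1)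

/-- `Ψ̂ = ∑_{k ≥ 1} R ^ (k - 1) A_k`, the `U`-measure at the levels above the lowest one. -/
def psiHat (A : ℕ → Matrix (Fin m) (Fin m) ℝ) (R : Matrix (Fin m) (Fin m) ℝ) :
    Matrix (Fin m) (Fin m) ℝ :=
  psiSum A R 0

/-- `Ψ̂₀ = (A₀ + A₁) + ∑_{k ≥ 2} R R ^ (k - 2) A_k`, the `U`-measure of `tailMatrix A` at its
lowest level. -/
def psiHatZero (A : ℕ → Matrix (Fin m) (Fin m) ℝ) (R : Matrix (Fin m) (Fin m) ℝ) :
    Matrix (Fin m) (Fin m) ℝ :=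
  (A 0 + A 1) + ∑' k : ℕ, R * R ^ k * A (k + 2)

/-- `R₁ = B₀ (I - Ψ̂)⁻¹`, the `R`-measure of the chain from level `0` to level `1`. -/
def rOne (B₀ : Matrix (Fin m₀) (Fin m) ℝ) (A : ℕ → Matrix (Fin m) (Fin m) ℝ)
    (R : Matrix (Fin m) (Fin m) ℝ) : Matrix (Fin m₀) (Fin m) ℝ :=
  B₀ * (1 - psiHat A R)⁻¹

/-! ### Infinite block matrices and the UL-type RG-factorization -/

/-- Infinite matrices of `m × m` blocks. -/
abbrev BlockMatrix (m : ℕ) : Type := Matrix ℕ ℕ (Matrix (Fin m) (Fin m) ℝ)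

/-- The product of infinite block matrices. -/
def blockMul (M N : BlockMatrix m) : BlockMatrix m := fun i j => ∑' k : ℕ, M i k * N k j

/-- The block matrix `ℙ` with block rows `(A₀ + A₁, A₀, 0, …)`, `(A₂, A₁, A₀, 0, …)`,
`(A₃, A₂, A₁, A₀, 0, …)`, …. -/
def tailMatrix (A : ℕ → Matrix (Fin m) (Fin m) ℝ) : BlockMatrix m := fun i j =>
  if i = 0 ∧ j = 0 then A 0 + A 1 else if j ≤ i + 1 then A (i + 1 - j) else 0

/-- `R_U`: the blocks just above the diagonal are `R`, all others vanish. -/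
def upperR (R : Matrix (Fin m) (Fin m) ℝ) : BlockMatrix m := fun i j =>
  if j = i + 1 then R else 0

/-- `Φ_D = diag (Ψ̂₀, Ψ̂, Ψ̂, …)`. -/
def diagPsi (A : ℕ → Matrix (Fin m) (Fin m) ℝ) (R : Matrix (Fin m) (Fin m) ℝ) : BlockMatrix m :=
  Matrix.diagonal fun i => if i = 0 then psiHatZero A R else psiHat A R

/-- `G_L`: strictly lower triangular, with block `(I - Ψ̂)⁻¹ ∑_{k ≥ n + 1} R ^ (k - n - 1) A_k`
at distance `n ≥ 1` below the diagonal. -/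
def lowerG (A : ℕ → Matrix (Fin m) (Fin m) ℝ) (R : Matrix (Fin m) (Fin m) ℝ) : BlockMatrix m :=
  fun i j => if j < i then (1 - psiHat A R)⁻¹ * psiSum A R (i - j) else 0

end GIM1

end

namespace GIM1

/-! ### Entrywise order of real matrices -/

section Entrywise

variable {k l m : Type*} [Fintype l]

/-! Write `X k` for the stationary subvector of level `k + 1` and `Ψ n` for `psiSum A R n`. The
balance equations read `X (k+1) = ∑ n, X (k+n) A n`. Comparison with the iterates increasing to the
minimal solution gives `X k R ≤ X (k+1)` (`vecMul_le_succ`). Since `X 0 > 0` and `X` is summable, `∑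
R ^ n` converges (`summable_pow`), and with it every other series.

Equality `X (k+1) = X k R` and invertibility of `1 - Ψ 0` both follow from one uniqueness statement,
`eq_zero_of_hasSum_psiSum`: a nonnegative summable `d` with `d k = ∑ i, d (k+i) Ψ i` vanishes.
Counting mass shows that such a `d` loses nothing to level `0` (`mul_escape_eq_zero`); the states
reached from its support would then form a closed set avoiding level `0`, against irreducibility.
The uniqueness is applied to `X (k+1) - X k R`, and to `|u|` for a left null vector `u` of `1 - Ψ
0`.

The rest is algebra from `R = A 0 + R Ψ 0` and `Ψ n = A (n+1) + R Ψ (n+1)`: these give the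
factorization and `1 - Ψ̂₀ = (1 - R)(1 - Ψ̂)`, which identifies the two forms of the tails. -/

theorem mul_apply_nonneg {M : Matrix k l ℝ} {N : Matrix l m ℝ} (hM : ∀ i j, 0 ≤ M i j)
    (hN : ∀ i j, 0 ≤ N i j) (i : k) (j : m) : 0 ≤ (M * N) i j :=
  Finset.sum_nonneg fun a _ => mul_nonneg (hM i a) (hN a j)

theorem mul_apply_mono {M M' : Matrix k l ℝ} {N N' : Matrix l m ℝ} (hM' : ∀ i j, 0 ≤ M' i j)
    (hN : ∀ i j, 0 ≤ N i j) (hMM' : ∀ i j, M i j ≤ M' i j) (hNN' : ∀ i j, N i j ≤ N' i j)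
    (i : k) (j : m) : (M * N) i j ≤ (M' * N') i j :=
  Finset.sum_le_sum fun a _ => mul_le_mul (hMM' i a) (hNN' a j) (hN a j) (hM' i a)

theorem mul_apply_pos {M : Matrix k l ℝ} {N : Matrix l m ℝ} (hM : ∀ i j, 0 ≤ M i j)
    (hN : ∀ i j, 0 ≤ N i j) {i : k} {a : l} {j : m} (h₁ : 0 < M i a) (h₂ : 0 < N a j) :
    0 < (M * N) i j :=
  Finset.sum_pos' (fun b _ => mul_nonneg (hM i b) (hN b j))
    ⟨a, Finset.mem_univ a, mul_pos h₁ h₂⟩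

theorem pow_apply_nonneg [DecidableEq l] {M : Matrix l l ℝ} (hM : ∀ i j, 0 ≤ M i j) (n : ℕ) :
    ∀ i j, 0 ≤ (M ^ n) i j := by
  induction n with
  | zero => intro i j; rw [pow_zero, Matrix.one_apply]; split_ifs <;> norm_num
  | succ n ih => rw [pow_succ]; exact mul_apply_nonneg ih hM

theorem pow_apply_mono [DecidableEq l] {M N : Matrix l l ℝ} (hM : ∀ i j, 0 ≤ M i j)
    (hMN : ∀ i j, M i j ≤ N i j) (n : ℕ) : ∀ i j, (M ^ n) i j ≤ (N ^ n) i j := by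
  have hN : ∀ i j, 0 ≤ N i j := fun i j => (hM i j).trans (hMN i j)
  induction n with
  | zero => intro i j; rw [pow_zero, pow_zero]
  | succ n ih =>
    rw [pow_succ, pow_succ]
    exact mul_apply_mono (pow_apply_nonneg hN n) hM ih hMN

theorem vecMul_apply_nonneg {v : l → ℝ} {M : Matrix l m ℝ} (hv : ∀ i, 0 ≤ v i)
    (hM : ∀ i j, 0 ≤ M i j) (j : m) : 0 ≤ (v ᵥ* M) j :=
  Finset.sum_nonneg fun a _ => mul_nonneg (hv a) (hM a j)

theorem vecMul_apply_mono {v w : l → ℝ} {M : Matrix l m ℝ} (hvw : ∀ i, v i ≤ w i)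
    (hM : ∀ i j, 0 ≤ M i j) (j : m) : (v ᵥ* M) j ≤ (w ᵥ* M) j :=
  Finset.sum_le_sum fun a _ => mul_le_mul_of_nonneg_right (hvw a) (hM a j)

theorem vecMul_apply_pos {v : l → ℝ} {M : Matrix l m ℝ} (hv : ∀ i, 0 ≤ v i)
    (hM : ∀ i j, 0 ≤ M i j) {a : l} {j : m} (h₁ : 0 < v a) (h₂ : 0 < M a j) :
    0 < (v ᵥ* M) j :=
  Finset.sum_pos' (fun b _ => mul_nonneg (hv b) (hM b j)) ⟨a, Finset.mem_univ a, mul_pos h₁ h₂⟩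

theorem mulVec_apply_nonneg {v : l → ℝ} {M : Matrix k l ℝ} (hv : ∀ i, 0 ≤ v i)
    (hM : ∀ i j, 0 ≤ M i j) (i : k) : 0 ≤ (M *ᵥ v) i :=
  Finset.sum_nonneg fun a _ => mul_nonneg (hM i a) (hv a)

theorem mulVec_apply_pos {v : l → ℝ} {M : Matrix k l ℝ} (hv : ∀ i, 0 ≤ v i)
    (hM : ∀ i j, 0 ≤ M i j) {i : k} {a : l} (h₁ : 0 < M i a) (h₂ : 0 < v a) :
    0 < (M *ᵥ v) i :=
  Finset.sum_pos' (fun b _ => mul_nonneg (hM i b) (hv b)) ⟨a, Finset.mem_univ a, mul_pos h₁ h₂⟩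

end Entrywise

/-! ### Sums of matrices and double series -/

section Sums

variable {ι k l m : Type*}

theorem hasSum_matrix_iff {f : ι → Matrix l m ℝ} {a : Matrix l m ℝ} :
    HasSum f a ↔ ∀ i j, HasSum (fun n => f n i j) (a i j) := by
  refine Pi.hasSum.trans (forall_congr' fun i => ?_)
  exact Pi.hasSum

theorem summable_matrix_iff {f : ι → Matrix l m ℝ} :
    Summable f ↔ ∀ i j, Summable (fun n => f n i j) := by
  refine Pi.summable.trans (forall_congr' fun i => ?_)
  exact Pi.summable

theorem summable_matrix_of_le {f g : ι → Matrix l m ℝ} (hf : ∀ n i j, 0 ≤ f n i j)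
    (hfg : ∀ n i j, f n i j ≤ g n i j) (hg : Summable g) : Summable f :=
  summable_matrix_iff.2 fun i j => Summable.of_nonneg_of_le (fun n => hf n i j)
    (fun n => hfg n i j) (summable_matrix_iff.1 hg i j)

theorem hasSum_vecMul [Fintype l] {f : ι → Matrix l m ℝ} {a : Matrix l m ℝ} (hf : HasSum f a)
    (v : l → ℝ) : HasSum (fun n => v ᵥ* f n) (v ᵥ* a) :=
  hf.map (⟨⟨fun M => v ᵥ* M, Matrix.vecMul_zero v⟩, fun M N => Matrix.vecMul_add M N v⟩ :
    Matrix l m ℝ →+ (m → ℝ)) (Continuous.matrix_vecMul continuous_const continuous_id)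

theorem hasSum_mulVec [Fintype m] {f : ι → Matrix l m ℝ} {a : Matrix l m ℝ} (hf : HasSum f a)
    (v : m → ℝ) : HasSum (fun n => f n *ᵥ v) (a *ᵥ v) :=
  hf.map (⟨⟨fun M => M *ᵥ v, Matrix.zero_mulVec v⟩, fun M N => Matrix.add_mulVec M N v⟩ :
    Matrix l m ℝ →+ (l → ℝ)) (Continuous.matrix_mulVec continuous_id continuous_const)

theorem hasSum_const_mulVec [Fintype m] {f : ι → m → ℝ} {a : m → ℝ} (hf : HasSum f a)
    (M : Matrix l m ℝ) : HasSum (fun n => M *ᵥ f n) (M *ᵥ a) :=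
  hf.map (⟨⟨fun v => M *ᵥ v, Matrix.mulVec_zero M⟩, fun v w => Matrix.mulVec_add M v w⟩ :
    (m → ℝ) →+ (l → ℝ)) (Continuous.matrix_mulVec continuous_const continuous_id)

/-- Tonelli: by nonnegativity, convergence of the diagonal sums gives summability over `ℕ × ℕ`, and
any regrouping has the same sum. -/
theorem hasSum_rows_of_hasSum_antidiagonal {f : ℕ → ℕ → ℝ} (hf : ∀ i j, 0 ≤ f i j) {a : ℝ}
    (h : HasSum (fun q => ∑ p ∈ Finset.HasAntidiagonal.antidiagonal q, f p.1 p.2) a) {g : ℕ → ℝ}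
    (hg : ∀ i, HasSum (f i) (g i)) : HasSum g a := by
  have hs : Summable fun x : (Σ q : ℕ, Finset.HasAntidiagonal.antidiagonal q) => f x.2.1.1 x.2.1.2 := by
    refine (summable_sigma_of_nonneg fun x => hf _ _).2 ⟨fun q => Summable.of_finite, ?_⟩
    convert h.summable using 2 with q
    rw [tsum_fintype, Finset.sum_coe_sort _ (fun p : ℕ × ℕ => f p.1 p.2)]
  have hp : Summable fun p : ℕ × ℕ => f p.1 p.2 := by
    rw [← Finset.HasAntidiagonal.sigmaAntidiagonalEquivProd.summable_iff]
    exact hs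
  have h₁ := hp.hasSum.prod_fiberwise (fun i => hg i)
  have h₂ : HasSum (fun q => ∑ p ∈ Finset.HasAntidiagonal.antidiagonal q, f p.1 p.2)
      (∑' p : ℕ × ℕ, f p.1 p.2) := by
    have := (Finset.HasAntidiagonal.sigmaAntidiagonalEquivProd (A := ℕ)).hasSum_iff.2 hp.hasSum
    refine this.sigma fun q => ?_
    rw [← Finset.sum_coe_sort _ (fun p : ℕ × ℕ => f p.1 p.2)]
    exact hasSum_fintype _
  rwa [h.unique h₂]

theorem hasSum_antidiagonal_of_hasSum_rows {f : ℕ → ℕ → ℝ} (hf : ∀ i j, 0 ≤ f i j) {a : ℝ}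
    {g : ℕ → ℝ} (hg : ∀ i, HasSum (f i) (g i)) (h : HasSum g a) :
    HasSum (fun q => ∑ p ∈ Finset.HasAntidiagonal.antidiagonal q, f p.1 p.2) a := by
  have hp : Summable fun p : ℕ × ℕ => f p.1 p.2 := by
    refine (summable_prod_of_nonneg fun p => hf _ _).2 ⟨fun i => (hg i).summable, ?_⟩
    convert h.summable using 2 with i
    exact (hg i).tsum_eq
  have h₁ := hp.hasSum.prod_fiberwise (fun i => hg i)
  have h₂ : HasSum (fun q => ∑ p ∈ Finset.HasAntidiagonal.antidiagonal q, f p.1 p.2)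
      (∑' p : ℕ × ℕ, f p.1 p.2) := by
    have := (Finset.HasAntidiagonal.sigmaAntidiagonalEquivProd (A := ℕ)).hasSum_iff.2 hp.hasSum
    refine this.sigma fun q => ?_
    rw [← Finset.sum_coe_sort _ (fun p : ℕ × ℕ => f p.1 p.2)]
    exact hasSum_fintype _
  rwa [h.unique h₁]

end Sums

/-! ### Irreducible stochastic matrices -/

section Chain

variable {S : Type*} {P : Matrix S S ℝ}

/-- The form in which irreducibility is used: follow a path of positive transitions from `s` to `t`
inside the closed set. -/
theorem mem_of_isIrreducible (hP : P.IsIrreducible) {C : Set S}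
    (hC : ∀ s ∈ C, ∀ t, 0 < P s t → t ∈ C) {s : S} (hs : s ∈ C) (t : S) : t ∈ C := by
  let : Quiver S := Matrix.toQuiver P
  obtain ⟨p, -⟩ := hP.connected s t
  induction p with
  | nil => exact hs
  | cons _ e ih => exact hC _ ih _ e.down

theorem IsStationary.pos (hP : P.IsIrreducible) {x : S → ℝ} (hx : IsStationary P x) (t : S) :
    0 < x t := by
  obtain ⟨hx₀, hx₁, hxP⟩ := hx
  obtain ⟨s, hs⟩ : ∃ s, 0 < x s := by
    by_contra! h
    have : x = 0 := funext fun s => le_antisymm (h s) (hx₀ s)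
    rw [this] at hx₁
    exact zero_ne_one (hasSum_zero.unique hx₁)
  refine mem_of_isIrreducible hP (C := {s | 0 < x s}) (fun s hs t hst => ?_) hs t
  exact (mul_pos hs hst).trans_le
    (le_hasSum (hxP t) s fun u _ => mul_nonneg (hx₀ u) (hP.nonneg u t))

end Chain

variable {m₀ m : ℕ}

/-! ### Blocks of the transition matrix -/

section Blocks

variable {B₁ : Matrix (Fin m₀) (Fin m₀) ℝ} {B₀ : Matrix (Fin m₀) (Fin m) ℝ}
  {B : ℕ → Matrix (Fin m) (Fin m₀) ℝ} {A : ℕ → Matrix (Fin m) (Fin m) ℝ}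

theorem transition_inr_inr_add (k n : ℕ) (i j : Fin m) :
    transition B₁ B₀ B A (Sum.inr (k + n, i)) (Sum.inr (n + 1, j)) = A k i j := by
  simp only [transition]
  rw [if_pos (by omega)]
  congr 1
  omega

theorem block_nonneg (hP : IsStochastic (transition B₁ B₀ B A)) (k : ℕ) (i j : Fin m) :
    0 ≤ A k i j := by
  rw [← transition_inr_inr_add (B₁ := B₁) (B₀ := B₀) (B := B) (A := A) k 0 i j]
  exact hP.1 _ _

theorem block_le_one (hP : IsStochastic (transition B₁ B₀ B A)) (k : ℕ) (i j : Fin m) :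
    A k i j ≤ 1 := by
  rw [← transition_inr_inr_add (B₁ := B₁) (B₀ := B₀) (B := B) (A := A) k 0 i j]
  exact le_hasSum (hP.2 _) _ fun t _ => hP.1 _ t

/-- `1 - ∑_{n ≤ l} A_n 1`, the probability of a jump from level `l` to level `0`, for `l ≥ 1`. -/
noncomputable def rowDefect (A : ℕ → Matrix (Fin m) (Fin m) ℝ) (l : ℕ) : Fin m → ℝ :=
  1 - ∑ n ∈ Finset.range (l + 1), A n *ᵥ 1

theorem rowDefect_succ (A : ℕ → Matrix (Fin m) (Fin m) ℝ) (l : ℕ) :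
    rowDefect A l - rowDefect A (l + 1) = A (l + 1) *ᵥ 1 := by
  rw [rowDefect, rowDefect, Finset.sum_range_succ _ (l + 1)]
  abel

theorem rowDefect_eq_sum (hP : IsStochastic (transition B₁ B₀ B A)) (l : ℕ) (i : Fin m) :
    rowDefect A (l + 1) i = ∑ j, B (l + 2) i j := by
  have h₁ : HasSum ((fun t => transition B₁ B₀ B A (Sum.inr (l, i)) t) ∘ Sum.inl)
      (∑ j, B (l + 2) i j) := hasSum_fintype _
  have h₂ : HasSum ((fun t => transition B₁ B₀ B A (Sum.inr (l, i)) t) ∘ Sum.inr)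
      (∑ n ∈ Finset.range (l + 2), ∑ j, A n i j) := by
    have h := hasSum_sum_of_ne_finset_zero (L := SummationFilter.unconditional _)
      (f := (fun t => transition B₁ B₀ B A (Sum.inr (l, i)) t) ∘ Sum.inr)
      (s := Finset.range (l + 2) ×ˢ Finset.univ) (fun p hp => ?_)
    · convert h using 1
      rw [Finset.sum_product, ← Finset.sum_range_reflect]
      refine Finset.sum_congr rfl fun n hn => Finset.sum_congr rfl fun j _ => ?_
      have := Finset.mem_range.1 hn
      simp only [Function.comp, transition]
      rw [if_pos (by omega)]
      congr 1
    · obtain ⟨n, j⟩ := p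
      simp only [Finset.mem_product, Finset.mem_range, Finset.mem_univ, and_true] at hp
      simp only [Function.comp, transition]
      rw [if_neg (by omega)]
  have h := (hP.2 (Sum.inr (l, i))).unique (h₁.sum h₂)
  simp only [rowDefect, Pi.sub_apply, Pi.one_apply, Finset.sum_apply, Matrix.mulVec, dotProduct,
    mul_one]
  linarith

theorem transition_inr_inl_le_rowDefect (hP : IsStochastic (transition B₁ B₀ B A)) (l : ℕ)
    (i : Fin m) (j : Fin m₀) :
    transition B₁ B₀ B A (Sum.inr (l, i)) (Sum.inl j) ≤ rowDefect A (l + 1) i := by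
  rw [rowDefect_eq_sum hP]
  exact Finset.single_le_sum (f := fun j => B (l + 2) i j)
    (fun j _ => hP.1 (Sum.inr (l, i)) (Sum.inl j)) (Finset.mem_univ j)

theorem rowDefect_nonneg (hP : IsStochastic (transition B₁ B₀ B A)) (l : ℕ) (i : Fin m) :
    0 ≤ rowDefect A l i := by
  have h : ∀ l, 0 ≤ rowDefect A (l + 1) i := fun l => by
    rw [rowDefect_eq_sum hP]
    exact Finset.sum_nonneg fun j _ => hP.1 (Sum.inr (l, i)) (Sum.inl j)
  cases l with
  | zero =>
    -- Index `0` belongs to no row of the chain; the defect decreases in `l`, so it is bounded below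
    -- by the one at index `1`.
    have h₁ := congrFun (rowDefect_succ A 0) i
    have h₂ : 0 ≤ (A (0 + 1) *ᵥ 1) i :=
      mulVec_apply_nonneg (fun _ => zero_le_one) (block_nonneg hP _) i
    rw [Pi.sub_apply] at h₁
    linarith [h 0]
  | succ l => exact h l

theorem rowDefect_le_one (hP : IsStochastic (transition B₁ B₀ B A)) (l : ℕ) (i : Fin m) :
    rowDefect A l i ≤ 1 := by
  rw [rowDefect, Pi.sub_apply, Finset.sum_apply, Pi.one_apply, sub_le_self_iff]
  exact Finset.sum_nonneg fun n _ =>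
    mulVec_apply_nonneg (fun _ => zero_le_one) (block_nonneg hP _) i

/-- Without level `0` the levels above the lowest one would be closed. -/
theorem pos_of_isIrreducible (hP : IsStochastic (transition B₁ B₀ B A))
    (hirr : (transition B₁ B₀ B A).IsIrreducible) (i : Fin m) : 0 < m₀ := by
  by_contra h₀
  obtain rfl : m₀ = 0 := by omega
  have hdef : ∀ l, rowDefect A (l + 1) = 0 := fun l => by
    ext i
    rw [rowDefect_eq_sum hP]
    simp
  -- Consecutive defects both vanish, so `A (k + 2)` has zero row sums: no downward jump is
  -- possible.
  have hA : ∀ k i j, A (k + 2) i j = 0 := fun k i j => by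
    have h := congrFun (rowDefect_succ A (k + 1)) i
    rw [hdef, hdef, sub_zero, Pi.zero_apply, Matrix.mulVec, dotProduct] at h
    have h' := (Finset.sum_eq_zero_iff_of_nonneg fun j _ =>
      mul_nonneg (block_nonneg hP (k + 2) i j) zero_le_one).1 h.symm j (Finset.mem_univ j)
    simpa using h'
  have hC := mem_of_isIrreducible hirr (C := {s | ∃ n j, s = Sum.inr (n + 1, j)})
    (s := Sum.inr (1, i)) ?_ ⟨0, i, rfl⟩ (Sum.inr (0, i))
  · obtain ⟨n, j, h⟩ := hC
    simp at h
  · rintro _ ⟨n, j, rfl⟩ (t | ⟨l, t⟩) hst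
    · exact t.elim0
    · cases l with
      | zero =>
        simp only [transition, Nat.zero_le, if_true] at hst
        rw [show n + 1 + 1 - 0 = n + 2 by omega, hA] at hst
        exact (lt_irrefl _ hst).elim
      | succ l => exact ⟨l, t, rfl⟩

end Blocks

/-! ### The stationary vector -/

section Stationary

variable {B₁ : Matrix (Fin m₀) (Fin m₀) ℝ} {B₀ : Matrix (Fin m₀) (Fin m) ℝ}
  {B : ℕ → Matrix (Fin m) (Fin m₀) ℝ} {A : ℕ → Matrix (Fin m) (Fin m) ℝ}
  {x : State m₀ m → ℝ}

theorem summable_level (hx : IsStationary (transition B₁ B₀ B A) x) :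
    Summable fun n : ℕ => level x (n + 1) := by
  rw [Pi.summable]
  intro j
  exact hx.2.1.summable.comp_injective (i := fun n : ℕ => (Sum.inr (n, j) : State m₀ m))
    fun a b h => by simpa using h

theorem hasSum_inr_of_rows {f : ℕ × Fin m → ℝ} (hf : Summable f) :
    HasSum (fun n => ∑ i, f (n, i)) (∑' p, f p) :=
  hf.hasSum.prod_fiberwise fun _ => hasSum_fintype _

theorem hasSum_level_succ (hx : IsStationary (transition B₁ B₀ B A) x) (k : ℕ) :
    HasSum (fun n => level x (k + 1 + n) ᵥ* A n) (level x (k + 2)) := by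
  rw [Pi.hasSum]
  intro j
  have h := hx.2.2 (Sum.inr (k + 1, j))
  have hinl : HasSum ((fun s => x s * transition B₁ B₀ B A s (Sum.inr (k + 1, j))) ∘ Sum.inl) 0 := by
    convert (hasSum_zero : HasSum (fun _ : Fin m₀ => (0 : ℝ)) 0) using 2 with i
    simp [transition]
  have hs : Summable ((fun s => x s * transition B₁ B₀ B A s (Sum.inr (k + 1, j))) ∘ Sum.inr) :=
    h.summable.comp_injective Sum.inr_injective
  have h₁ := h.unique (hinl.sum hs.hasSum)
  have h₂ := hasSum_inr_of_rows hs
  rw [zero_add] at h₁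
  rw [← h₁] at h₂
  -- The chain climbs at most one level per step, so levels `1, …, k` do not feed level `k + 2`.
  rw [← hasSum_nat_add_iff' k, Finset.sum_eq_zero, sub_zero] at h₂
  · have heq : ∀ n, (level x (k + 1 + n) ᵥ* A n) j = ∑ i,
        ((fun s => x s * transition B₁ B₀ B A s (Sum.inr (k + 1, j))) ∘ Sum.inr) (n + k, i) := by
      intro n
      change ∑ i, level x (k + 1 + n) i * A n i j = _
      refine Finset.sum_congr rfl fun i _ => ?_
      simp only [Function.comp]
      rw [transition_inr_inr_add, level, show k + 1 + n - 1 = n + k by omega]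
    simp only [heq]
    exact h₂
  · intro n hn
    have := Finset.mem_range.1 hn
    refine Finset.sum_eq_zero fun i _ => ?_
    simp only [Function.comp, transition]
    rw [if_neg (by omega), mul_zero]

theorem hasSum_level_one (hx : IsStationary (transition B₁ B₀ B A) x) :
    HasSum (fun n => level x (n + 1) ᵥ* A (n + 1)) (level x 1 - levelZero x ᵥ* B₀) := by
  rw [Pi.hasSum]
  intro j
  have h := hx.2.2 (Sum.inr (0, j))
  have hinl : HasSum ((fun s => x s * transition B₁ B₀ B A s (Sum.inr (0, j))) ∘ Sum.inl)
      ((levelZero x ᵥ* B₀) j) := hasSum_fintype _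
  have hs : Summable ((fun s => x s * transition B₁ B₀ B A s (Sum.inr (0, j))) ∘ Sum.inr) :=
    h.summable.comp_injective Sum.inr_injective
  have h₁ := h.unique (hinl.sum hs.hasSum)
  have h₂ := hasSum_inr_of_rows hs
  have h₃ : level x 1 j = x (Sum.inr (0, j)) := rfl
  rw [Pi.sub_apply, h₃, h₁, add_sub_cancel_left]
  exact h₂

end Stationary

/-! ### Approximation of the minimal solution from below -/

section Iterates

open Filter Topology

variable {A : ℕ → Matrix (Fin m) (Fin m) ℝ} {R : Matrix (Fin m) (Fin m) ℝ}

/-- The successive approximations `X ↦ ∑_k X ^ k A_k` of the minimal solution, from `0`. -/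
noncomputable def rIter (A : ℕ → Matrix (Fin m) (Fin m) ℝ) : ℕ → Matrix (Fin m) (Fin m) ℝ
  | 0 => 0
  | n + 1 => ∑' k : ℕ, rIter A n ^ k * A k

theorem summable_pow_mul_of_le (hA : ∀ k i j, 0 ≤ A k i j)
    (hR : HasSum (fun k : ℕ => R ^ k * A k) R) {X : Matrix (Fin m) (Fin m) ℝ}
    (hX : ∀ i j, 0 ≤ X i j) (hXR : ∀ i j, X i j ≤ R i j) :
    Summable fun k : ℕ => X ^ k * A k := by
  have hR₀ : ∀ i j, 0 ≤ R i j := fun i j => (hX i j).trans (hXR i j)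
  exact summable_matrix_of_le (fun k => mul_apply_nonneg (pow_apply_nonneg hX k) (hA k))
    (fun k => mul_apply_mono (pow_apply_nonneg hR₀ k) (hA k) (pow_apply_mono hX hXR k)
      fun _ _ => le_rfl) hR.summable

theorem hasSum_pow_mul_mono (hA : ∀ k i j, 0 ≤ A k i j) {X Y X' Y' : Matrix (Fin m) (Fin m) ℝ}
    (hX : ∀ i j, 0 ≤ X i j) (hXY : ∀ i j, X i j ≤ Y i j)
    (hX' : HasSum (fun k : ℕ => X ^ k * A k) X') (hY' : HasSum (fun k : ℕ => Y ^ k * A k) Y')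
    (i j : Fin m) : X' i j ≤ Y' i j :=
  hasSum_le (fun k => mul_apply_mono
    (pow_apply_nonneg (fun i j => (hX i j).trans (hXY i j)) k) (hA k) (pow_apply_mono hX hXY k)
    (fun _ _ => le_rfl) i j) (hasSum_matrix_iff.1 hX' i j) (hasSum_matrix_iff.1 hY' i j)

theorem rIter_bounds (hA : ∀ k i j, 0 ≤ A k i j) (hR : IsMinimalSolution A R) (n : ℕ) :
    (∀ i j, 0 ≤ rIter A n i j) ∧ (∀ i j, rIter A n i j ≤ R i j) := by
  induction n with
  | zero => exact ⟨fun _ _ => le_rfl, hR.1⟩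
  | succ n ih =>
    have hs := (summable_pow_mul_of_le hA hR.2.1 ih.1 ih.2).hasSum
    refine ⟨fun i j => (hasSum_matrix_iff.1 hs i j).nonneg fun k => ?_,
      hasSum_pow_mul_mono hA ih.1 ih.2 hs hR.2.1⟩
    exact mul_apply_nonneg (pow_apply_nonneg ih.1 k) (hA k) i j

theorem hasSum_rIter_succ (hA : ∀ k i j, 0 ≤ A k i j) (hR : IsMinimalSolution A R) (n : ℕ) :
    HasSum (fun k : ℕ => rIter A n ^ k * A k) (rIter A (n + 1)) :=
  (summable_pow_mul_of_le hA hR.2.1 (rIter_bounds hA hR n).1 (rIter_bounds hA hR n).2).hasSum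

theorem rIter_le_succ (hA : ∀ k i j, 0 ≤ A k i j) (hR : IsMinimalSolution A R) (n : ℕ) :
    ∀ i j, rIter A n i j ≤ rIter A (n + 1) i j := by
  induction n with
  | zero => exact (rIter_bounds hA hR 1).1
  | succ n ih =>
    exact hasSum_pow_mul_mono hA (rIter_bounds hA hR n).1 ih (hasSum_rIter_succ hA hR n)
      (hasSum_rIter_succ hA hR (n + 1))

/-- The iterates increase and stay below `R`. Dominated convergence, with majorant `R ^ k * A k`,
makes their limit a solution, and minimality forces it to be `R`. -/
theorem tendsto_rIter (hA : ∀ k i j, 0 ≤ A k i j) (hR : IsMinimalSolution A R) :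
    Tendsto (rIter A) atTop (𝓝 R) := by
  obtain ⟨Y, hY⟩ : ∃ Y : Matrix (Fin m) (Fin m) ℝ, Tendsto (rIter A) atTop (𝓝 Y) := by
    refine ⟨fun i j => ⨆ n, rIter A n i j, ?_⟩
    refine tendsto_pi_nhds.2 fun i => tendsto_pi_nhds.2 fun j => ?_
    exact tendsto_atTop_ciSup (monotone_nat_of_le_succ fun n => rIter_le_succ hA hR n i j)
      ⟨R i j, Set.forall_mem_range.2 fun n => (rIter_bounds hA hR n).2 i j⟩
  have hYij : ∀ i j, Tendsto (fun n => rIter A n i j) atTop (𝓝 (Y i j)) := fun i j =>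
    tendsto_pi_nhds.1 (tendsto_pi_nhds.1 hY i) j
  have hY₀ : ∀ i j, 0 ≤ Y i j := fun i j =>
    ge_of_tendsto' (hYij i j) fun n => (rIter_bounds hA hR n).1 i j
  have hYR : ∀ i j, Y i j ≤ R i j := fun i j =>
    le_of_tendsto' (hYij i j) fun n => (rIter_bounds hA hR n).2 i j
  have hsum : HasSum (fun k : ℕ => Y ^ k * A k) Y := by
    have hs := summable_pow_mul_of_le hA hR.2.1 hY₀ hYR
    refine hasSum_matrix_iff.2 fun i j => ?_
    have hlim : Tendsto (fun n => ∑' k : ℕ, (rIter A n ^ k * A k) i j) atTop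
        (𝓝 (∑' k : ℕ, (Y ^ k * A k) i j)) := by
      refine tendsto_tsum_of_dominated_convergence (bound := fun k : ℕ => (R ^ k * A k) i j)
        (hasSum_matrix_iff.1 hR.2.1 i j).summable (fun k => ?_) (Eventually.of_forall fun n k => ?_)
      · have : Tendsto (fun n => rIter A n ^ k * A k) atTop (𝓝 (Y ^ k * A k)) :=
          (hY.pow k).mul_const (A k)
        exact tendsto_pi_nhds.1 (tendsto_pi_nhds.1 this i) j
      · obtain ⟨h₀, h₁⟩ := rIter_bounds hA hR n
        rw [Real.norm_of_nonneg (mul_apply_nonneg (pow_apply_nonneg h₀ k) (hA k) i j)]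
        exact mul_apply_mono (pow_apply_nonneg hR.1 k) (hA k) (pow_apply_mono h₀ h₁ k)
          (fun _ _ => le_rfl) i j
    have heq : (fun n => ∑' k : ℕ, (rIter A n ^ k * A k) i j) = fun n => rIter A (n + 1) i j :=
      funext fun n => (hasSum_matrix_iff.1 (hasSum_rIter_succ hA hR n) i j).tsum_eq
    rw [heq] at hlim
    rw [tendsto_nhds_unique ((tendsto_add_atTop_iff_nat 1).2 (hYij i j)) hlim]
    exact (summable_matrix_iff.1 hs i j).hasSum
  have : Y = R := by
    ext i j
    exact le_antisymm (hYR i j) (hR.2.2 Y hY₀ hsum i j)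
  rwa [this] at hY

theorem vecMul_pow_le {X : ℕ → Fin m → ℝ} {M : Matrix (Fin m) (Fin m) ℝ} (hM : ∀ i j, 0 ≤ M i j)
    (h : ∀ k j, (X k ᵥ* M) j ≤ X (k + 1) j) (k n : ℕ) : ∀ j, (X k ᵥ* M ^ n) j ≤ X (k + n) j := by
  induction n with
  | zero => intro j; simp
  | succ n ih =>
    intro j
    rw [pow_succ, ← Matrix.vecMul_vecMul]
    exact (vecMul_apply_mono ih hM j).trans (h (k + n) j)

/-- A nonnegative solution of the balance equations grows at least as fast as the powers of the
minimal solution. -/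
theorem vecMul_le_succ (hA : ∀ k i j, 0 ≤ A k i j) (hR : IsMinimalSolution A R)
    {X : ℕ → Fin m → ℝ} (hX₀ : ∀ k j, 0 ≤ X k j)
    (hX : ∀ k, HasSum (fun n => X (k + n) ᵥ* A n) (X (k + 1))) (k : ℕ) (j : Fin m) :
    (X k ᵥ* R) j ≤ X (k + 1) j := by
  -- `k` stays general in the induction: bounding the `q`-th term uses the hypothesis at `q`
  -- successive levels.
  have h : ∀ n k j, (X k ᵥ* rIter A n) j ≤ X (k + 1) j := by
    intro n
    induction n with
    | zero => intro k j; simpa [rIter] using hX₀ (k + 1) j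
    | succ n ih =>
      intro k j
      refine hasSum_le (fun q => ?_)
        (Pi.hasSum.1 (hasSum_vecMul (hasSum_rIter_succ hA hR n) (X k)) j) (Pi.hasSum.1 (hX k) j)
      rw [← Matrix.vecMul_vecMul]
      exact vecMul_apply_mono (vecMul_pow_le (rIter_bounds hA hR n).1 ih k q) (hA q) j
  have hlim : Tendsto (fun n => X k ᵥ* rIter A n) atTop (𝓝 (X k ᵥ* R)) :=
    ((Continuous.matrix_vecMul continuous_const continuous_id).tendsto R).comp
      (tendsto_rIter hA hR)
  exact le_of_tendsto' (tendsto_pi_nhds.1 hlim j) fun n => h n k j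

/-- The geometric series of the minimal solution converges as soon as a positive summable solution
of the balance equations exists. -/
theorem summable_pow (hR₀ : ∀ i j, 0 ≤ R i j) {X : ℕ → Fin m → ℝ} (hX₀ : ∀ j, 0 < X 0 j)
    (hXR : ∀ k j, (X k ᵥ* R) j ≤ X (k + 1) j) (hXs : Summable X) :
    Summable fun n : ℕ => R ^ n := by
  refine summable_matrix_iff.2 fun i j => ?_
  refine Summable.of_nonneg_of_le (fun n => pow_apply_nonneg hR₀ n i j) (fun n => ?_)
    ((Pi.summable.1 hXs j).mul_left (X 0 i)⁻¹)
  rw [inv_mul_eq_div, le_div_iff₀' (hX₀ i)]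
  have h := vecMul_pow_le hR₀ hXR 0 n j
  rw [zero_add] at h
  refine le_trans ?_ h
  exact Finset.single_le_sum (f := fun a => X 0 a * (R ^ n) a j)
    (fun a _ => mul_nonneg (hX₀ a).le (pow_apply_nonneg hR₀ n a j)) (Finset.mem_univ i)

end Iterates

/-! ### The series defining the `U`- and `G`-measures -/

section Series

variable {A : ℕ → Matrix (Fin m) (Fin m) ℝ} {R : Matrix (Fin m) (Fin m) ℝ}

theorem isUnit_one_sub (hs : Summable fun n : ℕ => R ^ n) : IsUnit (1 - R) :=
  IsUnit.of_mul_eq_one _ hs.one_sub_mul_tsum_pow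

theorem summable_psiSum (hA : ∀ k i j, 0 ≤ A k i j) (hA₁ : ∀ k i j, A k i j ≤ 1)
    (hR : ∀ i j, 0 ≤ R i j) (hs : Summable fun n : ℕ => R ^ n) (n : ℕ) :
    Summable fun k : ℕ => R ^ k * A (k + n + 1) :=
  summable_matrix_of_le (g := fun k => R ^ k * Matrix.of fun _ _ => 1)
    (fun k => mul_apply_nonneg (pow_apply_nonneg hR k) (hA _))
    (fun k => mul_apply_mono (pow_apply_nonneg hR k) (hA _) (fun _ _ => le_rfl) (hA₁ _))
    (hs.mul_right _)

theorem psiSum_nonneg (hA : ∀ k i j, 0 ≤ A k i j) (hR : ∀ i j, 0 ≤ R i j)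
    (hψ : ∀ n : ℕ, Summable fun k : ℕ => R ^ k * A (k + n + 1)) (n : ℕ) (i j : Fin m) :
    0 ≤ psiSum A R n i j :=
  (hasSum_matrix_iff.1 (hψ n).hasSum i j).nonneg fun k =>
    mul_apply_nonneg (pow_apply_nonneg hR k) (hA _) i j

theorem pow_mul_le_psiSum (hA : ∀ k i j, 0 ≤ A k i j) (hR : ∀ i j, 0 ≤ R i j)
    (hψ : ∀ n : ℕ, Summable fun k : ℕ => R ^ k * A (k + n + 1)) (k n : ℕ) (i j : Fin m) :
    (R ^ k * A (k + n + 1)) i j ≤ psiSum A R n i j :=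
  le_hasSum (hasSum_matrix_iff.1 (hψ n).hasSum i j) k fun q _ =>
    mul_apply_nonneg (pow_apply_nonneg hR q) (hA _) i j

theorem hasSum_psiSum_succ (hψ : ∀ n : ℕ, Summable fun k : ℕ => R ^ k * A (k + n + 1)) (n : ℕ) :
    HasSum (fun k : ℕ => R * R ^ k * A (k + (n + 1) + 1)) (R * psiSum A R (n + 1)) := by
  simp only [Matrix.mul_assoc]
  exact (hψ (n + 1)).hasSum.mul_left R

theorem psiSum_eq (hψ : ∀ n : ℕ, Summable fun k : ℕ => R ^ k * A (k + n + 1)) (n : ℕ) :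
    psiSum A R n = A (n + 1) + R * psiSum A R (n + 1) := by
  have h : HasSum (fun k : ℕ => R ^ (k + 1) * A (k + 1 + n + 1)) (R * psiSum A R (n + 1)) := by
    simpa only [pow_succ', add_assoc, add_left_comm] using hasSum_psiSum_succ hψ n
  have h' := (hasSum_nat_add_iff (f := fun k : ℕ => R ^ k * A (k + n + 1)) 1).1 h
  rw [psiSum, h'.tsum_eq, add_comm]
  simp

theorem eq_add_mul_psiHat (hR : HasSum (fun k : ℕ => R ^ k * A k) R)
    (hψ : ∀ n : ℕ, Summable fun k : ℕ => R ^ k * A (k + n + 1)) :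
    R = A 0 + R * psiHat A R := by
  have h : HasSum (fun k : ℕ => R ^ (k + 1) * A (k + 1)) (R * psiHat A R) := by
    simp only [pow_succ', Matrix.mul_assoc]
    exact (hψ 0).hasSum.mul_left R
  have h' := (hasSum_nat_add_iff (f := fun k : ℕ => R ^ k * A k) 1).1 h
  have h'' := hR.unique h'
  rw [add_comm] at h''
  simpa using h''

theorem psiHatZero_eq (hψ : ∀ n : ℕ, Summable fun k : ℕ => R ^ k * A (k + n + 1)) :
    psiHatZero A R = A 0 + A 1 + R * psiSum A R 1 := by
  rw [psiHatZero, (hasSum_psiSum_succ hψ 0).tsum_eq]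

/-- Here `Ψ̂₀ = A₀ + Ψ̂` and `A₀ = R - R Ψ̂`. -/
theorem one_sub_psiHatZero (hR : HasSum (fun k : ℕ => R ^ k * A k) R)
    (hψ : ∀ n : ℕ, Summable fun k : ℕ => R ^ k * A (k + n + 1)) :
    1 - psiHatZero A R = (1 - R) * (1 - psiHat A R) := by
  have h₁ := eq_add_mul_psiHat hR hψ
  have h₂ := psiSum_eq hψ 0
  rw [← psiHat, zero_add] at h₂
  have h₃ : R * psiHat A R = R - A 0 := eq_sub_of_add_eq' h₁.symm
  rw [psiHatZero_eq hψ, sub_mul, one_mul, mul_sub, mul_one, h₃, h₂]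
  abel

end Series

/-! ### Row sums of the `U`- and `G`-measures -/

section RowSums

variable {B₁ : Matrix (Fin m₀) (Fin m₀) ℝ} {B₀ : Matrix (Fin m₀) (Fin m) ℝ}
  {B : ℕ → Matrix (Fin m) (Fin m₀) ℝ} {A : ℕ → Matrix (Fin m) (Fin m) ℝ}
  {R : Matrix (Fin m) (Fin m) ℝ}

/-- `∑_k R ^ k b_{l + k}`, where `b` is `rowDefect A`. -/
noncomputable def escape (A : ℕ → Matrix (Fin m) (Fin m) ℝ) (R : Matrix (Fin m) (Fin m) ℝ)
    (l : ℕ) : Fin m → ℝ :=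
  ∑' k : ℕ, R ^ k *ᵥ rowDefect A (l + k)

theorem hasSum_escape (hP : IsStochastic (transition B₁ B₀ B A)) (hR : ∀ i j, 0 ≤ R i j)
    (hs : Summable fun n : ℕ => R ^ n) (l : ℕ) :
    HasSum (fun k : ℕ => R ^ k *ᵥ rowDefect A (l + k)) (escape A R l) := by
  refine Summable.hasSum (Pi.summable.2 fun i => ?_)
  refine Summable.of_nonneg_of_le
    (fun k => mulVec_apply_nonneg (rowDefect_nonneg hP _) (pow_apply_nonneg hR k) i) (fun k => ?_)
    (Pi.summable.1 (hasSum_mulVec hs.hasSum 1).summable i)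
  exact Finset.sum_le_sum (s := Finset.univ) (f := fun a => (R ^ k) i a * rowDefect A (l + k) a)
    (g := fun a => (R ^ k) i a * 1) fun a _ =>
      mul_le_mul_of_nonneg_left (rowDefect_le_one hP _ a) (pow_apply_nonneg hR k i a)

theorem escape_nonneg (hP : IsStochastic (transition B₁ B₀ B A)) (hR : ∀ i j, 0 ≤ R i j)
    (hs : Summable fun n : ℕ => R ^ n) (l : ℕ) (i : Fin m) : 0 ≤ escape A R l i :=
  (Pi.hasSum.1 (hasSum_escape hP hR hs l) i).nonneg fun k =>
    mulVec_apply_nonneg (rowDefect_nonneg hP _) (pow_apply_nonneg hR k) i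

theorem mulVec_rowDefect_le_escape (hP : IsStochastic (transition B₁ B₀ B A))
    (hR : ∀ i j, 0 ≤ R i j) (hs : Summable fun n : ℕ => R ^ n) (l k : ℕ) (i : Fin m) :
    (R ^ k *ᵥ rowDefect A (l + k)) i ≤ escape A R l i :=
  le_hasSum (Pi.hasSum.1 (hasSum_escape hP hR hs l) i) k fun q _ =>
    mulVec_apply_nonneg (rowDefect_nonneg hP _) (pow_apply_nonneg hR q) i

theorem escape_sub_succ (hP : IsStochastic (transition B₁ B₀ B A)) (hR : ∀ i j, 0 ≤ R i j)
    (hs : Summable fun n : ℕ => R ^ n)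
    (hψ : ∀ n : ℕ, Summable fun k : ℕ => R ^ k * A (k + n + 1)) (l : ℕ) :
    escape A R l - escape A R (l + 1) = psiSum A R l *ᵥ 1 := by
  refine ((hasSum_escape hP hR hs l).sub (hasSum_escape hP hR hs (l + 1))).unique ?_
  have h := hasSum_mulVec (hψ l).hasSum 1
  have heq : ∀ k, R ^ k *ᵥ rowDefect A (l + k) - R ^ k *ᵥ rowDefect A (l + 1 + k) =
      (R ^ k * A (k + l + 1)) *ᵥ 1 := fun k => by
    rw [← Matrix.mulVec_sub, show l + 1 + k = l + k + 1 by omega, rowDefect_succ,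
      Matrix.mulVec_mulVec, add_comm l k]
  simp only [heq]
  exact h

/-- Splitting off the first term gives `e₀ = 1 - A₀ 1 + R e₁`, while `R (e₀ - e₁) = R Ψ̂ 1 = (R -
A₀) 1`. Together `(1 - R) e₀ = (1 - R) 1`, and `1 - R` is invertible. -/
theorem escape_zero (hP : IsStochastic (transition B₁ B₀ B A)) (hR : ∀ i j, 0 ≤ R i j)
    (hRA : HasSum (fun k : ℕ => R ^ k * A k) R) (hs : Summable fun n : ℕ => R ^ n)
    (hψ : ∀ n : ℕ, Summable fun k : ℕ => R ^ k * A (k + n + 1)) : escape A R 0 = 1 := by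
  have h₁ : escape A R 0 = rowDefect A 0 + R *ᵥ escape A R 1 := by
    have h : HasSum (fun k : ℕ => R ^ (k + 1) *ᵥ rowDefect A (0 + (k + 1)))
        (R *ᵥ escape A R 1) := by
      have := hasSum_const_mulVec (hasSum_escape hP hR hs 1) R
      simpa only [Matrix.mulVec_mulVec, ← pow_succ', zero_add, add_comm 1] using this
    have h' := (hasSum_nat_add_iff (f := fun k : ℕ => R ^ k *ᵥ rowDefect A (0 + k)) 1).1 h
    rw [(hasSum_escape hP hR hs 0).unique h', add_comm]
    simp
  have h₂ : rowDefect A 0 = 1 - A 0 *ᵥ 1 := by simp [rowDefect]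
  have h₃ := congrArg (fun v => R *ᵥ v) (escape_sub_succ hP hR hs hψ 0)
  simp only [zero_add, Matrix.mulVec_sub, Matrix.mulVec_mulVec] at h₃
  have h₄ : R * psiSum A R 0 = R - A 0 := eq_sub_of_add_eq' (eq_add_mul_psiHat hRA hψ).symm
  have h₅ : (1 - R) *ᵥ escape A R 0 = (1 - R) *ᵥ 1 := by
    rw [h₄, Matrix.sub_mulVec] at h₃
    rw [Matrix.sub_mulVec, Matrix.sub_mulVec, Matrix.one_mulVec, Matrix.one_mulVec]
    have h₆ : R *ᵥ escape A R 0 = R *ᵥ 1 - A 0 *ᵥ 1 + R *ᵥ escape A R 1 :=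
      eq_add_of_sub_eq h₃
    rw [h₆, h₁, h₂]
    abel
  exact Matrix.mulVec_injective_of_isUnit (isUnit_one_sub hs) h₅

/-- The differences `escape_sub_succ` telescope from `escape_zero`. Heuristically, the first return
from level `l` to the levels at most `l` is certain and ends either in levels `1, …, l` or in level
`0`. -/
theorem sum_psiSum_mulVec_one (hP : IsStochastic (transition B₁ B₀ B A)) (hR : ∀ i j, 0 ≤ R i j)
    (hRA : HasSum (fun k : ℕ => R ^ k * A k) R) (hs : Summable fun n : ℕ => R ^ n)
    (hψ : ∀ n : ℕ, Summable fun k : ℕ => R ^ k * A (k + n + 1)) (l : ℕ) :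
    ∑ n ∈ Finset.range l, psiSum A R n *ᵥ 1 = 1 - escape A R l := by
  rw [← escape_zero hP hR hRA hs hψ, ← Finset.sum_range_sub']
  exact Finset.sum_congr rfl fun n _ => by
    rw [escape_sub_succ hP hR hs hψ, escape_zero hP hR hRA hs hψ]

end RowSums

/-! ### Uniqueness for the balance equations of the censored levels -/

section Uniqueness

variable {B₁ : Matrix (Fin m₀) (Fin m₀) ℝ} {B₀ : Matrix (Fin m₀) (Fin m) ℝ}
  {B : ℕ → Matrix (Fin m) (Fin m₀) ℝ} {A : ℕ → Matrix (Fin m) (Fin m) ℝ}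
  {R : Matrix (Fin m) (Fin m) ℝ} {d : ℕ → Fin m → ℝ}

theorem hasSum_dotProduct {ι κ : Type*} [Fintype κ] {f : ι → κ → ℝ} {a : κ → ℝ}
    (hf : HasSum f a) (v : κ → ℝ) : HasSum (fun n => f n ⬝ᵥ v) (a ⬝ᵥ v) :=
  hasSum_sum fun j _ => (Pi.hasSum.1 hf j).mul_right (v j)

/-- The mass of an invariant vector escapes nowhere. -/
theorem mul_escape_eq_zero (hP : IsStochastic (transition B₁ B₀ B A))
    (hR : IsMinimalSolution A R) (hs : Summable fun n : ℕ => R ^ n)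
    (hψ : ∀ n : ℕ, Summable fun k : ℕ => R ^ k * A (k + n + 1))
    (hd₀ : ∀ k j, 0 ≤ d k j) (hds : Summable d)
    (hd : ∀ k, HasSum (fun i => d (k + i) ᵥ* psiSum A R i) (d k)) (l : ℕ) (j : Fin m) :
    d l j * escape A R (l + 1) j = 0 := by
  have hrow : ∀ k, HasSum (fun i => d (k + i) ⬝ᵥ psiSum A R i *ᵥ 1) (d k ⬝ᵥ 1) := fun k => by
    simp only [Matrix.dotProduct_mulVec]
    exact hasSum_dotProduct (hd k) 1
  have hcol : HasSum (fun k => d k ⬝ᵥ 1) ((∑' k, d k) ⬝ᵥ 1) := hasSum_dotProduct hds.hasSum 1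
  have hnn : ∀ k i, 0 ≤ d (k + i) ⬝ᵥ psiSum A R i *ᵥ 1 := fun k i =>
    Finset.sum_nonneg fun a _ => mul_nonneg (hd₀ _ a)
      (mulVec_apply_nonneg (fun _ => zero_le_one) (psiSum_nonneg (block_nonneg hP) hR.1 hψ i) a)
  -- Regrouped by source index `q = k + i`, the total mass of `d` becomes `∑ q, d q ⬝ᵥ (1 - escape A
  -- R (q + 1))`; index `q` stands for level `q + 1`.
  have hdiag := hasSum_antidiagonal_of_hasSum_rows
    (f := fun k i => d (k + i) ⬝ᵥ psiSum A R i *ᵥ 1) hnn hrow hcol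
  have heq : ∀ q, ∑ p ∈ Finset.HasAntidiagonal.antidiagonal q,
      d (p.1 + p.2) ⬝ᵥ psiSum A R p.2 *ᵥ 1 = d q ⬝ᵥ 1 - d q ⬝ᵥ escape A R (q + 1) := fun q => by
    rw [← dotProduct_sub, ← sum_psiSum_mulVec_one hP hR.1 hR.2.1 hs hψ, dotProduct_sum,
      ← Finset.Nat.sum_antidiagonal_swap, Finset.Nat.sum_antidiagonal_eq_sum_range_succ_mk]
    refine Finset.sum_congr rfl fun n hn => ?_
    have := Finset.mem_range.1 hn
    simp only [Prod.fst_swap, Prod.snd_swap]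
    rw [show q - n + n = q by omega]
  simp only [heq] at hdiag
  have hzero : HasSum (fun q => d q ⬝ᵥ escape A R (q + 1)) 0 := by
    simpa using hcol.sub hdiag
  have hterm : ∀ q a, 0 ≤ d q a * escape A R (q + 1) a := fun q a =>
    mul_nonneg (hd₀ q a) (escape_nonneg hP hR.1 hs _ a)
  have h := congrFun ((hasSum_zero_iff_of_nonneg fun q =>
    Finset.sum_nonneg fun a _ => hterm q a).1 hzero) l
  exact (Finset.sum_eq_zero_iff_of_nonneg fun a _ => hterm l a).1 h j (Finset.mem_univ j)

theorem eq_zero_of_hasSum_psiSum (hP : IsStochastic (transition B₁ B₀ B A))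
    (hirr : (transition B₁ B₀ B A).IsIrreducible)
    (hR : IsMinimalSolution A R) (hs : Summable fun n : ℕ => R ^ n)
    (hψ : ∀ n : ℕ, Summable fun k : ℕ => R ^ k * A (k + n + 1))
    (hd₀ : ∀ k j, 0 ≤ d k j) (hds : Summable d)
    (hd : ∀ k, HasSum (fun i => d (k + i) ᵥ* psiSum A R i) (d k)) (l : ℕ) (j : Fin m) :
    d l j = 0 := by
  by_contra hne
  have hA := block_nonneg hP
  have hpos : 0 < d l j := lt_of_le_of_ne (hd₀ l j) (Ne.symm hne)
  have hm₀ := pos_of_isIrreducible hP hirr j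
  have hpow := pow_apply_nonneg hR.1
  -- States at height `k` in an excursion above a state charged by `d`. The three cases below are a
  -- jump to level `0`, excluded by `mul_escape_eq_zero`; a move staying strictly above the base;
  -- and a landing at or below it.
  let C : Set (State m₀ m) := {s | ∃ n k i a, s = Sum.inr (n + k, a) ∧ 0 < d n i ∧
    0 < (R ^ k) i a}
  have hmem : (Sum.inl ⟨0, hm₀⟩ : State m₀ m) ∈ C := by
    refine mem_of_isIrreducible hirr (C := C) ?_ (s := Sum.inr (l, j))
      ⟨l, 0, j, j, rfl, hpos, by simp⟩ _
    rintro _ ⟨n, k, i, a, rfl, hdi, hRk⟩ (t | ⟨l', t⟩) hst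
    · exfalso
      have h₁ : 0 < rowDefect A (n + 1 + k) a := by
        rw [show n + 1 + k = n + k + 1 by omega]
        exact hst.trans_le (transition_inr_inl_le_rowDefect hP _ a t)
      have h₂ : 0 < escape A R (n + 1) i :=
        (mulVec_apply_pos (rowDefect_nonneg hP _) (hpow k) hRk h₁).trans_le
          (mulVec_rowDefect_le_escape hP hR.1 hs (n + 1) k i)
      exact (mul_pos hdi h₂).ne' (mul_escape_eq_zero hP hR hs hψ hd₀ hds hd n i)
    · simp only [transition] at hst
      split_ifs at hst with hl'
      · by_cases hn : n < l'
        · obtain ⟨e, rfl⟩ : ∃ e, l' = n + (e + 1) := ⟨l' - n - 1, by omega⟩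
          refine ⟨n, e + 1, i, t, rfl, hdi, ?_⟩
          obtain ⟨q, rfl⟩ : ∃ q, k = e + q := ⟨k - e, by omega⟩
          rw [show n + (e + q) + 1 - (n + (e + 1)) = q by omega] at hst
          -- `R ^ q * A q ≤ R` entrywise, hence `R ^ (e + q) * A q ≤ R ^ (e + 1)`.
          have h₁ : 0 < (R ^ (e + q) * A q) i t := mul_apply_pos (hpow _) (hA q) hRk hst
          rw [pow_add, Matrix.mul_assoc] at h₁
          refine h₁.trans_le ?_
          rw [pow_succ]
          refine mul_apply_mono (hpow e) (mul_apply_nonneg (hpow q) (hA q)) (fun _ _ => le_rfl)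
            (fun b c => ?_) i t
          exact le_hasSum (hasSum_matrix_iff.1 hR.2.1 b c) q fun p _ =>
            mul_apply_nonneg (hpow p) (hA p) b c
        · obtain ⟨e, rfl⟩ : ∃ e, n = l' + e := ⟨n - l', by omega⟩
          refine ⟨l', 0, t, t, rfl, ?_, by simp⟩
          rw [show l' + e + k + 1 - l' = k + e + 1 by omega] at hst
          -- The landing state is charged by `d` through the invariance equation at `l'`, and
          -- becomes a new base with `k = 0`.
          have h₁ : 0 < psiSum A R e i t := (mul_apply_pos (hpow k) (hA _) hRk hst).trans_le
            (pow_mul_le_psiSum hA hR.1 hψ k e i t)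
          have hψ₀ := psiSum_nonneg hA hR.1 hψ
          exact (vecMul_apply_pos (hd₀ _) (hψ₀ e) hdi h₁).trans_le
            (le_hasSum (Pi.hasSum.1 (hd l') t) e fun p _ =>
              vecMul_apply_nonneg (hd₀ _) (hψ₀ p) t)
      · exact (lt_irrefl _ hst).elim
  obtain ⟨n, k, i, a, h, -⟩ := hmem
  exact Sum.inl_ne_inr h

/-- For a left null vector `u`, the triangle inequality gives `|u| ≤ |u| Ψ̂`. Row sums of `Ψ̂` are
at most `1`, so equality holds, and `|u|` placed at index `0` contradicts uniqueness. -/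
theorem isUnit_one_sub_psiHat (hP : IsStochastic (transition B₁ B₀ B A))
    (hirr : (transition B₁ B₀ B A).IsIrreducible)
    (hR : IsMinimalSolution A R) (hs : Summable fun n : ℕ => R ^ n)
    (hψ : ∀ n : ℕ, Summable fun k : ℕ => R ^ k * A (k + n + 1)) :
    IsUnit (1 - psiHat A R) := by
  rw [Matrix.isUnit_iff_isUnit_det, isUnit_iff_ne_zero]
  intro hdet
  obtain ⟨u, hu, hu'⟩ := Matrix.exists_vecMul_eq_zero_iff.2 hdet
  rw [Matrix.vecMul_sub, Matrix.vecMul_one, sub_eq_zero] at hu'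
  have hψ₀ := psiSum_nonneg (block_nonneg hP) hR.1 hψ 0
  set v : Fin m → ℝ := fun j => |u j| with hv
  have hv₀ : ∀ j, 0 ≤ v j := fun j => abs_nonneg _
  have hle : ∀ j, v j ≤ (v ᵥ* psiSum A R 0) j := fun j => by
    rw [show v j = |u j| from rfl, congrFun hu' j]
    change |∑ a, u a * psiSum A R 0 a j| ≤ ∑ a, |u a| * psiSum A R 0 a j
    refine (Finset.abs_sum_le_sum_abs _ _).trans (Finset.sum_le_sum fun a _ => ?_)
    rw [abs_mul, abs_of_nonneg (hψ₀ a j)]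
  have hmass : (v ᵥ* psiSum A R 0) ⬝ᵥ 1 ≤ v ⬝ᵥ 1 := by
    have h := sum_psiSum_mulVec_one hP hR.1 hR.2.1 hs hψ 1
    rw [Finset.sum_range_one] at h
    rw [← Matrix.dotProduct_mulVec, h, dotProduct_sub, sub_le_self_iff]
    exact Finset.sum_nonneg fun a _ => mul_nonneg (hv₀ a) (escape_nonneg hP hR.1 hs 1 a)
  have heq : v ᵥ* psiSum A R 0 = v := by
    have h : ∑ j, ((v ᵥ* psiSum A R 0) j - v j) = 0 := by
      refine le_antisymm ?_ (Finset.sum_nonneg fun j _ => sub_nonneg.2 (hle j))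
      rw [Finset.sum_sub_distrib]
      simpa [dotProduct] using hmass
    ext j
    exact sub_eq_zero.1 ((Finset.sum_eq_zero_iff_of_nonneg fun j _ => sub_nonneg.2 (hle j)).1 h j
      (Finset.mem_univ j))
  refine hu (funext fun j => abs_eq_zero.1 ?_)
  have hzero := eq_zero_of_hasSum_psiSum hP hirr hR hs hψ (d := fun k => if k = 0 then v else 0)
    (fun k i => ?_) (hasSum_single 0 fun k hk => if_neg hk).summable (fun k => ?_) 0 j
  · have h : v j = 0 := by simpa using hzero
    exact h
  · split_ifs
    · exact hv₀ i
    · exact le_rfl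
  · have h := hasSum_single (f := fun i => (if k + i = 0 then v else 0) ᵥ* psiSum A R i) 0
      (L := SummationFilter.unconditional _) fun i hi => by
        rw [if_neg (by omega), Matrix.zero_vecMul]
    rw [add_zero] at h
    rcases eq_or_ne k 0 with rfl | hk
    · rwa [if_pos rfl, heq] at h
    · rw [if_neg hk]
      rwa [if_neg hk, Matrix.zero_vecMul] at h

end Uniqueness

/-! ### The matrix-geometric form -/

section Geometric

variable {B₁ : Matrix (Fin m₀) (Fin m₀) ℝ} {B₀ : Matrix (Fin m₀) (Fin m) ℝ}
  {B : ℕ → Matrix (Fin m) (Fin m₀) ℝ} {A : ℕ → Matrix (Fin m) (Fin m) ℝ}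
  {R : Matrix (Fin m) (Fin m) ℝ} {X : ℕ → Fin m → ℝ}

theorem sum_antidiagonal_sub_vecMul_pow (k q : ℕ) :
    ∑ p ∈ Finset.HasAntidiagonal.antidiagonal q,
      (X (k + p.1 + 1) - X (k + p.1) ᵥ* R) ᵥ* R ^ p.2 =
      X (k + q + 1) - X k ᵥ* R ^ (q + 1) := by
  rw [Finset.Nat.sum_antidiagonal_eq_sum_range_succ_mk]
  have h := Finset.sum_range_sub (fun i => X (k + i) ᵥ* R ^ (q + 1 - i)) (q + 1)
  simp only [Nat.sub_self, pow_zero, Matrix.vecMul_one, add_zero, Nat.sub_zero] at h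
  rw [add_assoc k q 1, ← h]
  refine Finset.sum_congr rfl fun i hi => ?_
  have := Finset.mem_range.1 hi
  rw [Matrix.sub_vecMul, Matrix.vecMul_vecMul, ← pow_succ', show q + 1 - (i + 1) = q - i by omega,
    show q + 1 - i = q - i + 1 by omega, add_assoc]

/-- Subtract `X k R = ∑ n, X k R ^ n A n` from the balance equation: the terms `n = 0` cancel, and
each other difference telescopes into the defects `X (j+1) - X j R` times powers of `R`. The defects
are nonnegative, so the double series may be resummed by rows. -/
theorem hasSum_sub_vecMul_psiSum (hA : ∀ k i j, 0 ≤ A k i j) (hR₀ : ∀ i j, 0 ≤ R i j)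
    (hR : HasSum (fun k : ℕ => R ^ k * A k) R)
    (hψ : ∀ n : ℕ, Summable fun k : ℕ => R ^ k * A (k + n + 1))
    (hX : ∀ k, HasSum (fun n => X (k + n) ᵥ* A n) (X (k + 1)))
    (hXR : ∀ k j, (X k ᵥ* R) j ≤ X (k + 1) j) (k : ℕ) :
    HasSum (fun i => (X (k + i + 1) - X (k + i) ᵥ* R) ᵥ* psiSum A R i)
      (X (k + 1) - X k ᵥ* R) := by
  have hdiag : HasSum (fun q => (X (k + q + 1) - X k ᵥ* R ^ (q + 1)) ᵥ* A (q + 1))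
      (X (k + 1) - X k ᵥ* R) := by
    have h₁ := (hX k).sub (hasSum_vecMul hR (X k))
    have h₂ := (hasSum_nat_add_iff' 1).2 h₁
    simp only [Finset.sum_range_one, add_zero, pow_zero, Matrix.one_mul, sub_self, sub_zero] at h₂
    simpa only [Matrix.sub_vecMul, Matrix.vecMul_vecMul, add_assoc] using h₂
  refine Pi.hasSum.2 fun c => ?_
  refine hasSum_rows_of_hasSum_antidiagonal
    (f := fun i p => ((X (k + i + 1) - X (k + i) ᵥ* R) ᵥ* (R ^ p * A (p + i + 1))) c)
    (fun i p => ?_) ?_ fun i => Pi.hasSum.1 (hasSum_vecMul (hψ i).hasSum _) c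
  · exact vecMul_apply_nonneg (fun j => sub_nonneg.2 (hXR (k + i) j))
      (mul_apply_nonneg (pow_apply_nonneg hR₀ p) (hA _)) c
  · have heq : ∀ q, ∑ p ∈ Finset.HasAntidiagonal.antidiagonal q,
        ((X (k + p.1 + 1) - X (k + p.1) ᵥ* R) ᵥ* (R ^ p.2 * A (p.2 + p.1 + 1))) c =
        ((X (k + q + 1) - X k ᵥ* R ^ (q + 1)) ᵥ* A (q + 1)) c := fun q => by
      rw [← sum_antidiagonal_sub_vecMul_pow, Matrix.sum_vecMul, Finset.sum_apply]
      refine Finset.sum_congr rfl fun p hp => ?_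
      have := Finset.HasAntidiagonal.mem_antidiagonal.1 hp
      rw [show p.2 + p.1 + 1 = q + 1 by omega, Matrix.vecMul_vecMul]
    simp only [heq]
    exact Pi.hasSum.1 hdiag c

theorem eq_vecMul_pow (hP : IsStochastic (transition B₁ B₀ B A))
    (hirr : (transition B₁ B₀ B A).IsIrreducible)
    (hR : IsMinimalSolution A R) (hs : Summable fun n : ℕ => R ^ n)
    (hψ : ∀ n : ℕ, Summable fun k : ℕ => R ^ k * A (k + n + 1))
    (hX₀ : ∀ k j, 0 ≤ X k j) (hXs : Summable X)
    (hX : ∀ k, HasSum (fun n => X (k + n) ᵥ* A n) (X (k + 1))) (k : ℕ) :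
    X k = X 0 ᵥ* R ^ k := by
  have hA := block_nonneg hP
  have hXR := vecMul_le_succ hA hR hX₀ hX
  have hstep : ∀ k, X (k + 1) = X k ᵥ* R := fun k => by
    have hds : Summable fun k => X (k + 1) - X k ᵥ* R := by
      rw [Pi.summable]
      intro j
      refine Summable.of_nonneg_of_le (fun k => sub_nonneg.2 (hXR k j)) (fun k => ?_)
        ((summable_nat_add_iff 1).2 (Pi.summable.1 hXs j))
      exact sub_le_self _ (vecMul_apply_nonneg (hX₀ k) hR.1 j)
    have h := eq_zero_of_hasSum_psiSum hP hirr hR hs hψ (fun k j => sub_nonneg.2 (hXR k j)) hds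
      (hasSum_sub_vecMul_psiSum hA hR.1 hR.2.1 hψ hX hXR) k
    exact funext fun j => sub_eq_zero.1 (h j)
  induction k with
  | zero => simp
  | succ k ih => rw [hstep, ih, Matrix.vecMul_vecMul, ← pow_succ]

end Geometric

/-! ### The UL-type RG-factorization -/

section Factorization

variable {A : ℕ → Matrix (Fin m) (Fin m) ℝ} {R : Matrix (Fin m) (Fin m) ℝ}

theorem blockMul_one_sub_diagPsi (M : BlockMatrix m) (i j : ℕ) :
    blockMul M (1 - diagPsi A R) i j =
      M i j * (1 - if j = 0 then psiHatZero A R else psiHat A R) := by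
  rw [blockMul, tsum_eq_single j fun k hk => ?_]
  · simp [diagPsi]
  · simp [diagPsi, Matrix.one_apply_ne hk, Matrix.diagonal_apply_ne _ hk]

theorem factorization (hR : HasSum (fun k : ℕ => R ^ k * A k) R)
    (hψ : ∀ n : ℕ, Summable fun k : ℕ => R ^ k * A (k + n + 1))
    (hunit : IsUnit (1 - psiHat A R)) :
    1 - tailMatrix A =
      blockMul (blockMul (1 - upperR R) (1 - diagPsi A R)) (1 - lowerG A R) := by
  have hinv : ∀ M : Matrix (Fin m) (Fin m) ℝ,
      (1 - psiHat A R) * ((1 - psiHat A R)⁻¹ * M) = M := fun M =>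
    Matrix.mul_nonsing_inv_cancel_left _ _ ((Matrix.isUnit_iff_isUnit_det _).1 hunit)
  have hRψ : R * (1 - psiHat A R) = A 0 := by
    rw [Matrix.mul_sub, Matrix.mul_one, sub_eq_iff_eq_add]
    exact eq_add_mul_psiHat hR hψ
  refine funext fun i => funext fun j => ?_
  -- The left factor is upper bidiagonal. Row `0` of `lowerG` vanishes, so its inverse only ever
  -- meets `1 - Ψ̂`, never the corner block.
  rw [blockMul, tsum_eq_sum (s := {i, i + 1}) fun k hk => ?_]
  · rw [Finset.sum_pair (by omega), blockMul_one_sub_diagPsi, blockMul_one_sub_diagPsi]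
    simp only [Matrix.sub_apply, upperR, lowerG, tailMatrix, Matrix.one_apply_eq, if_true,
      Nat.succ_ne_zero, if_false, if_neg (Nat.succ_ne_self i).symm, sub_zero, Matrix.one_mul]
    rw [Matrix.one_apply_ne (by omega : i ≠ i + 1), zero_sub, Matrix.neg_mul, Matrix.neg_mul]
    rcases lt_trichotomy j i with hj | rfl | hj
    · rw [Matrix.one_apply_ne (by omega), Matrix.one_apply_ne (by omega), if_neg (by omega),
        if_pos (by omega), if_neg (by omega : ¬i = 0), if_pos hj, if_pos (by omega), zero_sub,
        zero_sub, zero_sub, Matrix.mul_neg, Matrix.mul_neg, hinv, Matrix.mul_assoc, hinv,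
        show i + 1 - j = i - j + 1 by omega, psiSum_eq hψ (i - j)]
      abel
    · rw [Matrix.one_apply_eq, Matrix.one_apply_ne (by omega), if_neg (lt_irrefl j),
        if_pos (by omega : j ≤ j + 1), if_pos (by omega : j < j + 1), sub_zero, mul_one, zero_sub,
        Matrix.mul_neg, Matrix.mul_assoc, hinv, neg_neg, show j + 1 - j = 1 by omega]
      rcases eq_or_ne j 0 with rfl | hj
      · rw [if_pos ⟨rfl, rfl⟩, if_pos rfl, psiHatZero_eq hψ]
        abel
      · rw [if_neg (fun h => hj h.1), if_neg hj, psiHat, psiSum_eq hψ 0]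
        abel
    · rw [Matrix.one_apply_ne (by omega : i ≠ j), if_neg (by omega : ¬(i = 0 ∧ j = 0)),
        if_neg (by omega : ¬j < i), if_neg (by omega : ¬j < i + 1), sub_zero, sub_zero, mul_zero,
        zero_add, hRψ, zero_sub]
      rcases eq_or_ne j (i + 1) with rfl | hj'
      · rw [if_pos le_rfl, Nat.sub_self, Matrix.one_apply_eq, Matrix.mul_one]
      · rw [if_neg (by omega), Matrix.one_apply_ne hj'.symm, Matrix.mul_zero]
  · simp only [Finset.mem_insert, Finset.mem_singleton, not_or] at hk
    rw [blockMul_one_sub_diagPsi]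
    simp [upperR, Matrix.one_apply_ne (Ne.symm hk.1), hk.2]

end Factorization

end GIM1

theorem mainTheorem5 (m₀ m : ℕ)
    (B₁ : Matrix (Fin m₀) (Fin m₀) ℝ) (B₀ : Matrix (Fin m₀) (Fin m) ℝ)
    (B : ℕ → Matrix (Fin m) (Fin m₀) ℝ) (A : ℕ → Matrix (Fin m) (Fin m) ℝ)
    (hP : GIM1.IsStochastic (GIM1.transition B₁ B₀ B A))
    (hirr : (GIM1.transition B₁ B₀ B A).IsIrreducible)
    (hrec : GIM1.IsPositiveRecurrent (GIM1.transition B₁ B₀ B A))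
    (x : GIM1.State m₀ m → ℝ) (hx : GIM1.IsStationary (GIM1.transition B₁ B₀ B A) x)
    (R : Matrix (Fin m) (Fin m) ℝ) (hR : GIM1.IsMinimalSolution A R) :
    -- all series and inverses that occur exist
    (∀ n : ℕ, Summable fun k : ℕ => R ^ k * A (k + n + 1)) ∧
    (Summable fun k : ℕ => R * R ^ k * A (k + 2)) ∧
    IsUnit (1 - R) ∧ IsUnit (1 - GIM1.psiHat A R) ∧ IsUnit (1 - GIM1.psiHatZero A R) ∧
    (∀ k : ℕ, 1 ≤ k → Summable fun n : ℕ => GIM1.level x (k + n)) ∧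
    -- the matrix-geometric form of the stationary vector and of its tails
    (∀ k : ℕ, 1 ≤ k →
      GIM1.level x k = GIM1.levelZero x ᵥ* (GIM1.rOne B₀ A R * R ^ (k - 1))) ∧
    (∀ k : ℕ, 1 ≤ k →
      GIM1.tailVec x k =
        GIM1.levelZero x ᵥ* (GIM1.rOne B₀ A R * (1 - R)⁻¹ * R ^ (k - 1))) ∧
    -- the UL-type RG-factorization
    1 - GIM1.tailMatrix A =
      GIM1.blockMul (GIM1.blockMul (1 - GIM1.upperR R) (1 - GIM1.diagPsi A R))
        (1 - GIM1.lowerG A R) ∧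
    -- the tails through the factorization
    (∀ k : ℕ, 1 ≤ k →
      GIM1.tailVec x k =
        GIM1.levelZero x ᵥ* (B₀ * (1 - GIM1.psiHatZero A R)⁻¹ * R ^ (k - 1))) ∧
    -- the comparison of the two forms
    GIM1.levelZero x ᵥ* (B₀ * (1 - GIM1.psiHatZero A R)⁻¹) =
      GIM1.levelZero x ᵥ* (GIM1.rOne B₀ A R * (1 - R)⁻¹) := by
  have hA := GIM1.block_nonneg hP
  let X : ℕ → Fin m → ℝ := fun k => GIM1.level x (k + 1)
  have hXpos : ∀ k j, 0 < X k j := fun k j => hx.pos hirr _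
  have hXs : Summable X := GIM1.summable_level hx
  have hX : ∀ k, HasSum (fun n => X (k + n) ᵥ* A n) (X (k + 1)) := fun k => by
    have h := GIM1.hasSum_level_succ hx k
    simpa only [X, add_right_comm k _ 1] using h
  have hXR := GIM1.vecMul_le_succ hA hR (fun k j => (hXpos k j).le) hX
  have hs := GIM1.summable_pow hR.1 (hXpos 0) hXR hXs
  have hψ := GIM1.summable_psiSum hA (GIM1.block_le_one hP) hR.1 hs
  have hunitR := GIM1.isUnit_one_sub hs
  have hunit := GIM1.isUnit_one_sub_psiHat hP hirr hR hs hψ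
  have hzero := GIM1.one_sub_psiHatZero hR.2.1 hψ
  have hgeo := GIM1.eq_vecMul_pow hP hirr hR hs hψ (fun k j => (hXpos k j).le) hXs hX
  have hfirst : X 0 = GIM1.levelZero x ᵥ* GIM1.rOne B₀ A R := by
    -- The balance equation of level `1`, with the geometric form inserted.
    have h₁ : X 0 - GIM1.levelZero x ᵥ* B₀ = X 0 ᵥ* GIM1.psiHat A R := by
      refine (GIM1.hasSum_level_one hx).unique ?_
      have h := GIM1.hasSum_vecMul (hψ 0).hasSum (X 0)
      have heq : ∀ n, GIM1.level x (n + 1) ᵥ* A (n + 1) = X 0 ᵥ* (R ^ n * A (n + 0 + 1)) :=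
        fun n => by rw [← Matrix.vecMul_vecMul, ← hgeo]
      simp only [heq]
      exact h
    have h₂ : X 0 ᵥ* (1 - GIM1.psiHat A R) = GIM1.levelZero x ᵥ* B₀ := by
      rw [Matrix.vecMul_sub, Matrix.vecMul_one, ← h₁, sub_sub_cancel]
    rw [GIM1.rOne, ← Matrix.vecMul_vecMul, ← h₂, Matrix.vecMul_vecMul,
      Matrix.mul_nonsing_inv _ ((Matrix.isUnit_iff_isUnit_det _).1 hunit), Matrix.vecMul_one]
  have hlevel : ∀ k : ℕ, 1 ≤ k →
      GIM1.level x k = GIM1.levelZero x ᵥ* (GIM1.rOne B₀ A R * R ^ (k - 1)) := fun k hk => by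
    obtain ⟨k, rfl⟩ := Nat.exists_eq_add_of_le' hk
    rw [← Matrix.vecMul_vecMul, ← hfirst, Nat.add_sub_cancel, ← hgeo]
  have hsumR : HasSum (fun n : ℕ => R ^ n) (1 - R)⁻¹ := by
    rw [Matrix.inv_eq_right_inv hs.one_sub_mul_tsum_pow]
    exact hs.hasSum
  have htail : ∀ k : ℕ, 1 ≤ k → HasSum (fun n : ℕ => GIM1.level x (k + n))
      (GIM1.levelZero x ᵥ* (GIM1.rOne B₀ A R * (1 - R)⁻¹ * R ^ (k - 1))) := fun k hk => by
    have h := GIM1.hasSum_vecMul (hsumR.mul_right (R ^ (k - 1)))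
      (GIM1.levelZero x ᵥ* GIM1.rOne B₀ A R)
    have heq : ∀ n, GIM1.level x (k + n) =
        (GIM1.levelZero x ᵥ* GIM1.rOne B₀ A R) ᵥ* (R ^ n * R ^ (k - 1)) := fun n => by
      rw [hlevel (k + n) (by omega), Matrix.vecMul_vecMul, ← pow_add,
        show n + (k - 1) = k + n - 1 by omega]
    rw [Matrix.mul_assoc, ← Matrix.vecMul_vecMul]
    simp only [heq]
    exact h
  -- Inversion reverses the factors `(1 - R)(1 - Ψ̂)`, so the comparison holds already without `x₀`.
  have hcomp : B₀ * (1 - GIM1.psiHatZero A R)⁻¹ = GIM1.rOne B₀ A R * (1 - R)⁻¹ := by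
    rw [hzero, Matrix.mul_inv_rev, GIM1.rOne, Matrix.mul_assoc]
  refine ⟨hψ, (GIM1.hasSum_psiSum_succ hψ 0).summable, hunitR, hunit, ?_,
    fun k hk => (htail k hk).summable, hlevel, fun k hk => (htail k hk).tsum_eq,
    GIM1.factorization hR.2.1 hψ hunit, fun k hk => ?_, ?_⟩
  · rw [hzero]
    exact hunitR.mul hunit
  · rw [hcomp]
    exact (htail k hk).tsum_eq
  · rw [hcomp]
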